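/- **Definitions.** Let $\mathcal X$ be a set and $\mathcal H$ a class of functions $\mathcal X\to\mathbb R$. For $A=(x_1,\dots,x_m)\in\mathcal X^m$ put $\mathcal H|_A=\{(h(x_1),\dots,h(x_m)) : h\in\mathcal H\}$, viewed as a class of functions on $[m]$. A random function $\hat f$ is an $\varepsilon$-estimator of $f$ if for every $x$, $\mathbb E[\hat f(x)]=f(x)$ and $\mathrm{Var}(\hat f(x))\le\varepsilon^2$. An $(\varepsilon,n)$-compressor for $\mathcal H$ consists of a probability space $(\Omega,\mu)$, an encoder $C:\Omega\times\mathcal H\to\{0,1\}^*$ (measurable in $\omega$) and a decoder $D$ sending each bit string in $\{0,1\}^*$ to a function $\mathcal X\to\mathbb R$, such that for every $h\in\mathcal H$ the random function $D(C(\omega,h))$, $\omega\sim\mu$, is an $\varepsilon$-estimator of $h$, and the expected length of the string $C(\omega,h)$ is at most $n$. The class $\mathcal H$ has approximate description length (ADL) $n(m)$ if for every $m$ and every $A\in\mathcal X^m$ the restriction $\mathcal H|_A$ has a $(1,n(m))$-compressor. Let $\mathcal X_B\subseteq\mathbb R^d$ be a set of vectors of Euclidean norm at most $B$, let $W_0\in\mathbb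 R^{t\times d}$, $v_0\in\mathbb R^t$, and let $\sigma:\mathbb R^t\to\mathbb R^t$ be $L$-Lipschitz (Euclidean norm) and element-wise, that is, $\sigma(z)_j$ depends only on $z_j$ (and on $j$). Put $$\mathcal H^\sigma_{t,L,B,R,r}=\{\,x\in\mathcal X_B\mapsto\langle v,\sigma(Wx)\rangle : W\in\mathbb R^{t\times d},\ \|W-W_0\|_F\le R,\ v\in\mathbb R^t,\ \|v-v_0\|\le r\,\}.$$ **Theorem 1.** For every $K$ and every $c>0$ there is a constant $C>0$, depending only on $K$ and $c$, such that the following holds. Let $d\ge2$, $t\ge1$, and suppose that the spectral norm of $W_0$, the norm $\|v_0\|$ and all $|\sigma(0)_j|$ are at most $K$, and that $r\ge1$, $R\ge c$ and $LBRr\ge c$. Then $\mathcal H^\sigma_{t,L,B,R,r}$ has approximate description length $$n(m)=C\,L^2B^2R^2r^2\left(\log_2^2(dm)\,\log_2 d+\log_2 r+\log_2 t\right);$$ that is, for every $m\ge1$ and every $m$-tuple $A$ of inputs from $\mathcal X_B$, the restriction $\mathcal H^\sigma_{t,L,B,R,r}|_A$ has a $(1,n(m))$-compressor. In particular the dependence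 on the width $t$ is only logarithmic. -/

import Mathlib

open MeasureTheory
open scoped NNReal ENNReal

noncomputable section

namespace ADL

/-! ### Approximate description length -/

/-- The restriction of a class `H` of functions on `X` to a tuple `A = (x₁, …, x_m)`:
the set of all vectors `(h x₁, …, h x_m)` with `h ∈ H`, viewed as functions on `Fin m`. -/
def restrict {X E : Type*} (H : Set (X → E)) {m : ℕ} (A : Fin m → X) : Set (Fin m → E) :=
  {g | ∃ h ∈ H, g = fun i => h (A i)}

/-- The random function `fhat` (with randomness `ω ∼ μ`) is an `ε`-estimator of `f`: for every `x`,
`fhat x` has finite second moment and expectation `f x`, and its variance is at most `ε ^ 2` in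
every direction `u` of the unit sphere. -/
def IsEstimator {Ω X E : Type*} [MeasurableSpace Ω] [NormedAddCommGroup E] [InnerProductSpace ℝ E]
    (μ : Measure Ω) (ε : ℝ) (fhat : Ω → X → E) (f : X → E) : Prop :=
  ∀ x : X, MemLp (fun ω => fhat ω x) 2 μ ∧ ∫ ω, fhat ω x ∂μ = f x ∧
    ∀ u : E, ‖u‖ = 1 → ProbabilityTheory.variance (fun ω => inner ℝ u (fhat ω x)) μ ≤ ε ^ 2

/-- An `(ε, n)`-compressor `(C, D, len, Ω, μ)` for the class `H`. The encoder `C` is randomized; the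
decoder `D` sees only the bit string. -/
structure Compressor {X E : Type*} [NormedAddCommGroup E] [InnerProductSpace ℝ E]
    (H : Set (X → E)) (ε n : ℝ) where
  /-- the sample space -/
  Ω : Type
  /-- its `σ`-algebra -/
  mΩ : MeasurableSpace Ω
  /-- the law of the randomness -/
  μ : Measure Ω
  prob : IsProbabilityMeasure μ
  /-- the number of bits that are used -/
  len : Ω → H → ℕ
  /-- the encoder -/
  C : Ω → H → List Bool
  /-- the decoder -/
  D : List Bool → X → E
  measurable_C : ∀ (h : H) (s : List Bool), MeasurableSet {ω | C ω h = s}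
  length_C : ∀ ω h, (C ω h).length = len ω h
  estimator : ∀ h : H, IsEstimator μ ε (fun ω => D (C ω h)) h
  expected_len : ∀ h : H, ∫⁻ ω, (len ω h : ℝ≥0∞) ∂μ ≤ ENNReal.ofReal n

/-- The class `H` has approximate description length `n = n(m)`: for all `m` and all `A ∈ X ^ m`,
the restriction of `H` to `A` has a `(1, n(m))`-compressor. -/
def HasADL {X E : Type*} [NormedAddCommGroup E] [InnerProductSpace ℝ E]
    (H : Set (X → E)) (n : ℕ → ℝ) : Prop :=
  ∀ (m : ℕ) (A : Fin m → X), Nonempty (Compressor (restrict H A) 1 (n m))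

/-! ### Two-layer networks -/

/-- The Frobenius norm of a matrix. -/
def frobeniusNorm {t d : ℕ} (W : Matrix (Fin t) (Fin d) ℝ) : ℝ :=
  Real.sqrt (∑ i, ∑ j, W i j ^ 2)

/-- The spectral norm of a matrix (the operator norm for the Euclidean norms). -/
def spectralNorm {t d : ℕ} (W : Matrix (Fin t) (Fin d) ℝ) : ℝ :=
  ‖LinearMap.toContinuousLinearMap (Matrix.toEuclideanLin W)‖

/-- An activation is element-wise if it acts on each coordinate (neuron) separately. -/
def IsElementwise {t : ℕ} (σ : EuclideanSpace ℝ (Fin t) → EuclideanSpace ℝ (Fin t)) : Prop :=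
  ∃ φ : Fin t → ℝ → ℝ, ∀ z j, σ z j = φ j (z j)

/-- The class of the two-layer networks `x ↦ ⟨v, σ (W x)⟩` on the domain `X`, with `W` within
Frobenius distance `R` of `W₀` and `v` within Euclidean distance `r` of `v₀`. -/
def twoLayerClass {t d : ℕ} (X : Set (EuclideanSpace ℝ (Fin d)))
    (σ : EuclideanSpace ℝ (Fin t) → EuclideanSpace ℝ (Fin t))
    (W₀ : Matrix (Fin t) (Fin d) ℝ) (v₀ : EuclideanSpace ℝ (Fin t)) (R r : ℝ) : Set (X → ℝ) :=
  {h | ∃ (W : Matrix (Fin t) (Fin d) ℝ) (v : EuclideanSpace ℝ (Fin t)),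
    frobeniusNorm (W - W₀) ≤ R ∧ ‖v - v₀‖ ≤ r ∧
      h = fun x : X => inner ℝ v (σ (Matrix.toEuclideanLin W x.1))}

end ADL

end

/-! A network splits as ⟨v, σ(0)⟩ + ⟨v, σ(W₀x) − σ(0)⟩ + ∑ⱼ vⱼ ψⱼ(⟨uⱼ, x⟩), where uⱼ is the j-th row
of W − W₀ and ψⱼ, the change of neuron j from its initialization, is L-Lipschitz and vanishes at 0.
Each part gets an independent unbiased description, with variances 1/4, 1/4 and 1/2 (`network`).

A vector is described by a random coordinate and a rounded value, in O(log d) bits (`sketch`).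
Applying ψ to such an estimate would bias it. `lipschitz_comp` removes the bias by multilevel
telescoping: the passage from averages of 4^k sketches to averages of 4^(k+1) is long to describe
but small, so it is sent only with probability 4^(-k). About log m levels suffice, since the
remainder is then so small that m random signs, sent with probability at most 1/m, describe it.

The sum over neurons is importance sampled (`neurons`): a single neuron is drawn with probability
proportional to |vⱼ| times a dyadic bound for ‖uⱼ‖. By Cauchy–Schwarz the total weight is O(Rr), so
t enters only through the length of the label. Averaging O(L²B²R²r²) copies then brings the variance
down to a constant.

Prefix-free codes allow descriptions to be concatenated, and finitely supported distributions keep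
all expectations finite sums; measures appear only in `compressor`. -/

noncomputable section

namespace ADL

/-! ### Prefix codes -/

/-- A prefix-free binary code for the messages in `M`. -/
structure PrefixCode (M : Type) where
  /-- the code word of a message -/
  enc : M → List Bool
  prefix_free : ∀ a b s t, enc a ++ s = enc b ++ t → a = b ∧ s = t

namespace PrefixCode

variable {M N : Type}

/-- The length of the code word of `a`, as a real number. -/
def len (c : PrefixCode M) (a : M) : ℝ := (c.enc a).length

theorem len_nonneg (c : PrefixCode M) (a : M) : 0 ≤ c.len a := Nat.cast_nonneg _

theorem injective (c : PrefixCode M) : Function.Injective c.enc := fun a b h =>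
  (c.prefix_free a b [] [] (by simpa using h)).1

/-- Pull back a code along an injective map. -/
def comap (c : PrefixCode N) (f : M → N) (hf : Function.Injective f) : PrefixCode M where
  enc a := c.enc (f a)
  prefix_free _ _ _ _ h := ⟨hf (c.prefix_free _ _ _ _ h).1, (c.prefix_free _ _ _ _ h).2⟩

@[simp] theorem len_comap (c : PrefixCode N) (f : M → N) (hf : Function.Injective f) (a : M) :
    (c.comap f hf).len a = c.len (f a) := rfl

/-- The code of a dependent pair. -/
def sigma {β : Type} {M : β → Type} (c : PrefixCode β) (c' : ∀ b, PrefixCode (M b)) :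
    PrefixCode (Σ b, M b) where
  enc x := c.enc x.1 ++ (c' x.1).enc x.2
  prefix_free := by
    rintro ⟨a, x⟩ ⟨b, y⟩ s t h
    simp only [List.append_assoc] at h
    obtain ⟨rfl, h2⟩ := c.prefix_free _ _ _ _ h
    obtain ⟨rfl, h3⟩ := (c' a).prefix_free _ _ _ _ h2
    exact ⟨rfl, h3⟩

@[simp] theorem len_sigma {β : Type} {M : β → Type} (c : PrefixCode β)
    (c' : ∀ b, PrefixCode (M b)) (x : Σ b, M b) :
    (c.sigma c').len x = c.len x.1 + (c' x.1).len x.2 := by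
  simp [len, sigma]

/-- The code of a pair. -/
def prod (c : PrefixCode M) (c' : PrefixCode N) : PrefixCode (M × N) where
  enc x := c.enc x.1 ++ c'.enc x.2
  prefix_free := by
    rintro ⟨a, x⟩ ⟨b, y⟩ s t h
    simp only [List.append_assoc] at h
    obtain ⟨rfl, h2⟩ := c.prefix_free _ _ _ _ h
    obtain ⟨rfl, h3⟩ := c'.prefix_free _ _ _ _ h2
    exact ⟨rfl, h3⟩

@[simp] theorem len_prod (c : PrefixCode M) (c' : PrefixCode N) (x : M × N) :
    (c.prod c').len x = c.len x.1 + c'.len x.2 := by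
  simp [len, prod]

/-- The code of an optional message. -/
def option (c : PrefixCode M) : PrefixCode (Option M) where
  enc x := x.elim [false] fun a => true :: c.enc a
  prefix_free := by
    rintro (_ | a) (_ | b) s t h
    · simpa using h
    · simp at h
    · simp at h
    · simp only [Option.elim, List.cons_append, List.cons.injEq, true_and] at h
      obtain ⟨rfl, h2⟩ := c.prefix_free _ _ _ _ h
      exact ⟨rfl, h2⟩

@[simp] theorem len_option_none (c : PrefixCode M) : c.option.len none = 1 := by
  simp [len, option]

@[simp] theorem len_option_some (c : PrefixCode M) (a : M) :
    c.option.len (some a) = c.len a + 1 := by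
  simp [len, option]

/-- The code words of a list of messages. -/
def encList (c : PrefixCode M) : List M → List Bool
  | [] => [false]
  | a :: l => true :: (c.enc a ++ c.encList l)

/-- The code of a list of messages. -/
def list (c : PrefixCode M) : PrefixCode (List M) where
  enc := c.encList
  prefix_free := by
    intro a
    induction a with
    | nil =>
      rintro (_ | ⟨b, l⟩) s t h
      · simpa [encList] using h
      · simp [encList] at h
    | cons a k ih =>
      rintro (_ | ⟨b, l⟩) s t h
      · simp [encList] at h
      · simp only [encList, List.cons_append, List.cons.injEq, true_and, List.append_assoc] at h
        obtain ⟨rfl, h2⟩ := c.prefix_free _ _ _ _ h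
        obtain ⟨rfl, h3⟩ := ih _ _ _ h2
        exact ⟨rfl, h3⟩

@[simp] theorem len_list_nil (c : PrefixCode M) : c.list.len [] = 1 := by
  simp [len, list, encList]

@[simp] theorem len_list_cons (c : PrefixCode M) (a : M) (l : List M) :
    c.list.len (a :: l) = c.len a + 1 + c.list.len l := by
  simp [len, list, encList]; ring

/-- A fixed-length code. -/
theorem exists_fixed (M : Type) [Fintype M] {b : ℕ} (h : Fintype.card M ≤ 2 ^ b) :
    ∃ c : PrefixCode M, ∀ a, c.len a = b := by
  have h' : Fintype.card M ≤ Fintype.card (Fin b → Bool) := by simpa using h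
  obtain ⟨e⟩ := Function.Embedding.nonempty_of_card_le h'
  refine ⟨⟨fun a => List.ofFn (e a), fun a a' s t hs => ?_⟩, fun a => by simp [len]⟩
  obtain ⟨h1, h2⟩ := List.append_inj hs (by simp)
  exact ⟨e.injective (List.ofFn_injective h1), h2⟩

/-- The unary code. -/
theorem exists_unary : ∃ c : PrefixCode ℕ, ∀ n, c.len n = n + 1 := by
  obtain ⟨u, hu⟩ := exists_fixed Unit (b := 0) (by simp)
  -- Over a zero-length alphabet code, the list code consists of the continuation bits alone, which
  -- is unary.
  have hi : Function.Injective fun n : ℕ => List.replicate n () := fun a b h => by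
    simpa using congrArg List.length h
  refine ⟨u.list.comap _ hi, fun n => ?_⟩
  · rw [len_comap]
    induction n with
    | zero => simp
    | succ n ih => rw [List.replicate_succ, len_list_cons, ih, hu]; push_cast; ring

/-- The Golomb–Rice code of the integers. -/
theorem exists_rice (b : ℕ) :
    ∃ c : PrefixCode ℤ, ∀ z, c.len z ≤ b + |(z : ℝ)| / 2 ^ b + 2 := by
  obtain ⟨u, hu⟩ := exists_unary
  obtain ⟨f, hf⟩ := exists_fixed (Fin (2 ^ b)) (b := b) (by simp)
  obtain ⟨g, hg⟩ := exists_fixed Bool (b := 1) (by simp)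
  -- Sign, quotient by 2 ^ b in unary, remainder in b bits: the length stays near b when |z| is of
  -- order 2 ^ b.
  have hi : Function.Injective fun z : ℤ => ((decide (0 ≤ z), z.natAbs / 2 ^ b,
      ⟨z.natAbs % 2 ^ b, Nat.mod_lt _ (by positivity)⟩) : Bool × ℕ × Fin (2 ^ b)) := by
    intro x y h
    simp only [Prod.mk.injEq, decide_eq_decide, Fin.mk.injEq] at h
    have h3 : x.natAbs = y.natAbs := by
      rw [← Nat.div_add_mod x.natAbs (2 ^ b), h.2.1, h.2.2, Nat.div_add_mod]
    omega
  refine ⟨(g.prod (u.prod f)).comap _ hi, fun z => ?_⟩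
  · simp only [len_comap, len_prod, hu, hf, hg]
    have h1 : ((z.natAbs / 2 ^ b : ℕ) : ℝ) ≤ (z.natAbs : ℝ) / ((2 ^ b : ℕ) : ℝ) := Nat.cast_div_le
    have h2 : ((z.natAbs : ℕ) : ℝ) = |(z : ℝ)| := by
      rw [← Int.cast_natCast (R := ℝ), Int.natCast_natAbs]; simp
    rw [h2] at h1
    push_cast at h1 ⊢
    linarith

end PrefixCode

/-! ### Finitely supported probability distributions -/

/-- A finitely supported probability distribution. -/
structure FinDist (α : Type) where
  /-- the probability of a point -/
  w : α →₀ ℝ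
  nonneg : ∀ a, 0 ≤ w a
  total : (w.sum fun _ p => p) = 1

namespace FinDist

variable {α β : Type}

/-- The expectation of `f`. -/
def E (P : FinDist α) (f : α → ℝ) : ℝ := P.w.sum fun a p => p * f a

theorem E_eq (P : FinDist α) (f : α → ℝ) : P.E f = ∑ a ∈ P.w.support, P.w a * f a := rfl

@[simp] theorem E_const (P : FinDist α) (c : ℝ) : P.E (fun _ => c) = c := by
  have := P.total
  rw [E_eq, ← Finset.sum_mul]
  rw [Finsupp.sum] at this
  rw [this, one_mul]

theorem E_add (P : FinDist α) (f g : α → ℝ) : P.E (fun a => f a + g a) = P.E f + P.E g := by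
  simp [E_eq, mul_add, Finset.sum_add_distrib]

theorem E_sub (P : FinDist α) (f g : α → ℝ) : P.E (fun a => f a - g a) = P.E f - P.E g := by
  simp [E_eq, mul_sub, Finset.sum_sub_distrib]

theorem E_const_mul (P : FinDist α) (c : ℝ) (f : α → ℝ) : P.E (fun a => c * f a) = c * P.E f := by
  simp only [E_eq, Finset.mul_sum]
  exact Finset.sum_congr rfl fun a _ => by ring

theorem E_mono (P : FinDist α) {f g : α → ℝ} (h : ∀ a, f a ≤ g a) : P.E f ≤ P.E g :=
  Finset.sum_le_sum fun a _ => mul_le_mul_of_nonneg_left (h a) (P.nonneg a)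

theorem E_nonneg (P : FinDist α) {f : α → ℝ} (h : ∀ a, 0 ≤ f a) : 0 ≤ P.E f :=
  Finset.sum_nonneg fun a _ => mul_nonneg (P.nonneg a) (h a)

theorem E_sub_sq (P : FinDist α) (f : α → ℝ) (c : ℝ) :
    P.E (fun a => (f a - c) ^ 2) = P.E (fun a => f a ^ 2) - 2 * c * P.E f + c ^ 2 := by
  have : (fun a => (f a - c) ^ 2) = fun a => (f a ^ 2 - (2 * c) * f a) + c ^ 2 := by
    ext a; ring
  rw [this, E_add, E_sub, E_const_mul, E_const]

theorem sq_E_le (P : FinDist α) (f : α → ℝ) : P.E f ^ 2 ≤ P.E (fun a => f a ^ 2) := by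
  have := P.E_nonneg (f := fun a => (f a - P.E f) ^ 2) fun a => sq_nonneg _
  rw [E_sub_sq] at this
  nlinarith

/-- The distribution concentrated at a point. -/
def pure (a : α) : FinDist α where
  w := Finsupp.single a 1
  nonneg b := by classical rw [Finsupp.single_apply]; split_ifs <;> norm_num
  total := by simp

@[simp] theorem E_pure (a : α) (f : α → ℝ) : (pure a).E f = f a := by simp [E, pure]

theorem sum_bind (P : FinDist α) (Q : α → FinDist β) (f : β → ℝ) :
    ((P.w.sum fun a p => p • (Q a).w).sum fun b p => p * f b) = P.E fun a => (Q a).E f := by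
  rw [Finsupp.sum_sum_index (by simp) (by intros; ring)]
  refine Finset.sum_congr rfl fun a _ => ?_
  beta_reduce
  rw [Finsupp.sum_smul_index (by simp)]
  simp only [E, Finsupp.sum, Finset.mul_sum, mul_assoc]

/-- Draw `a` from `P` and then from `Q a`. -/
def bind (P : FinDist α) (Q : α → FinDist β) : FinDist β where
  w := P.w.sum fun a p => p • (Q a).w
  nonneg b := by
    simp only [Finsupp.sum, Finsupp.coe_finsetSum, Finset.sum_apply, Finsupp.smul_apply,
      smul_eq_mul]
    exact Finset.sum_nonneg fun a _ => mul_nonneg (P.nonneg a) ((Q a).nonneg b)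
  total := by
    have := sum_bind P Q fun _ => 1
    simpa using this

@[simp] theorem E_bind (P : FinDist α) (Q : α → FinDist β) (f : β → ℝ) :
    (P.bind Q).E f = P.E fun a => (Q a).E f := sum_bind P Q f

/-- The image of a distribution. -/
def map (g : α → β) (P : FinDist α) : FinDist β := P.bind fun a => pure (g a)

@[simp] theorem E_map (g : α → β) (P : FinDist α) (f : β → ℝ) :
    (P.map g).E f = P.E fun a => f (g a) := by simp [map]

/-- The product distribution. -/
def prod (P : FinDist α) (Q : FinDist β) : FinDist (α × β) := P.bind fun a => Q.map fun b => (a, b)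

@[simp] theorem E_prod (P : FinDist α) (Q : FinDist β) (f : α × β → ℝ) :
    (P.prod Q).E f = P.E fun a => Q.E fun b => f (a, b) := by simp [prod]

/-- A finite subprobability, completed by an extra point. -/
theorem exists_of_weights {J : Type} [Fintype J] (p : J → ℝ) (hp : ∀ j, 0 ≤ p j)
    (hs : ∑ j, p j ≤ 1) :
    ∃ P : FinDist (Option J), ∀ f, P.E f = (1 - ∑ j, p j) * f none + ∑ j, p j * f (some j) := by
  classical
  have key : ∀ f : Option J → ℝ, (Finsupp.equivFunOnFinite.symm
      (fun o : Option J => o.elim (1 - ∑ j, p j) p)).sum (fun a q => q * f a) =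
      (1 - ∑ j, p j) * f none + ∑ j, p j * f (some j) := fun f => by
    rw [Finsupp.sum_fintype _ _ (by simp), Fintype.sum_option]
    simp
  refine ⟨⟨_, ?_, ?_⟩, key⟩
  · rintro (_ | j)
    · simpa using hs
    · simpa using hp j
  · simpa using key fun _ => 1

/-- A biased coin with outcomes `x` and `y`. -/
theorem exists_coin (x y : α) {q : ℝ} (h0 : 0 ≤ q) (h1 : q ≤ 1) :
    ∃ P : FinDist α, ∀ f, P.E f = (1 - q) * f x + q * f y := by
  obtain ⟨P, hP⟩ := exists_of_weights (fun _ : Unit => q) (fun _ => h0) (by simpa using h1)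
  exact ⟨P.map fun o => o.elim x fun _ => y, fun f => by simp [hP]⟩

/-- Unbiased randomized rounding to the integers. -/
theorem exists_round (y : ℝ) : ∃ P : FinDist ℤ, P.E (fun z => (z : ℝ)) = y ∧
    P.E (fun z => (z : ℝ) ^ 2) ≤ y ^ 2 + 1 / 4 ∧ P.E (fun z => |(z : ℝ)|) ≤ |y| + 1 := by
  obtain ⟨k, q, e, h0, h1⟩ : ∃ (k : ℤ) (q : ℝ), y = k + q ∧ 0 ≤ q ∧ q ≤ 1 :=
    ⟨⌊y⌋, Int.fract y, (Int.floor_add_fract y).symm, Int.fract_nonneg y, (Int.fract_lt_one y).le⟩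
  obtain ⟨P, hP⟩ := exists_coin k (k + 1) h0 h1
  set a : ℝ := (k : ℝ)
  refine ⟨P, ?_, ?_, ?_⟩
  · rw [hP]; push_cast; rw [e]; ring
  · rw [hP]; push_cast; rw [e]; nlinarith [sq_nonneg (q - 1 / 2)]
  · rw [hP]; push_cast
    have ha : |a| ≤ |y| + q := by
      have : a = y - q := by linarith
      rw [this]
      exact (abs_sub _ _).trans (by rw [abs_of_nonneg h0])
    have hb : |a + 1| ≤ |y| + (1 - q) := by
      have : a + 1 = y + (1 - q) := by linarith
      rw [this]
      exact (abs_add_le _ _).trans (by rw [abs_of_nonneg (by linarith : 0 ≤ 1 - q)])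
    nlinarith [mul_le_mul_of_nonneg_left ha (by linarith : 0 ≤ 1 - q),
      mul_le_mul_of_nonneg_left hb h0, mul_nonneg h0 (by linarith : 0 ≤ 1 - q)]

/-- Random signs with given biases. -/
theorem exists_signs : ∀ {m : ℕ} (y : Fin m → ℝ), (∀ i, |y i| ≤ 1) →
    ∃ P : FinDist (Fin m → Bool), ∀ i, P.E (fun b => if b i then 1 else -1) = y i
  | 0, _, _ => ⟨pure default, fun i => i.elim0⟩
  | m + 1, y, hy => by
    obtain ⟨P, hP⟩ := exists_signs (fun i => y i.succ) fun i => hy _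
    have h := abs_le.1 (hy 0)
    obtain ⟨Q, hQ⟩ := exists_coin false true (q := (1 + y 0) / 2) (by linarith) (by linarith)
    refine ⟨(Q.prod P).map fun x => Fin.cons x.1 x.2, fun i => ?_⟩
    refine Fin.cases ?_ (fun i => ?_) i
    · simp [hQ]; ring
    · simp [hP]

/-- Lists of `n` independent draws. -/
def iid (P : FinDist α) : ℕ → FinDist (List α)
  | 0 => pure []
  | n + 1 => (P.prod (P.iid n)).map fun x => x.1 :: x.2

theorem E_iid_sum (P : FinDist α) (f : α → ℝ) (n : ℕ) :
    (P.iid n).E (fun l => (l.map f).sum) = n * P.E f := by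
  induction n with
  | zero => simp [iid]
  | succ n ih => simp [iid, E_add, ih]; ring

theorem E_iid_sum_sq (P : FinDist α) (f : α → ℝ) (n : ℕ) :
    (P.iid n).E (fun l => ((l.map f).sum - n * P.E f) ^ 2) =
      n * P.E (fun a => (f a - P.E f) ^ 2) := by
  induction n with
  | zero => simp [iid]
  | succ n ih =>
    -- Centring kills the cross term between the new draw and the earlier ones.
    have h0 : (P.iid n).E (fun l => (l.map f).sum - n * P.E f) = 0 := by
      rw [E_sub, E_iid_sum, E_const, sub_self]
    have h1 : ∀ a, (P.iid n).E (fun l => ((f a + (l.map f).sum) - (n + 1) * P.E f) ^ 2) =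
        (f a - P.E f) ^ 2 + n * P.E (fun a => (f a - P.E f) ^ 2) := fun a => by
      have : (fun l : List α => ((f a + (l.map f).sum) - (n + 1) * P.E f) ^ 2) = fun l =>
          (f a - P.E f) ^ 2 + ((2 * (f a - P.E f)) * ((l.map f).sum - n * P.E f) +
            ((l.map f).sum - n * P.E f) ^ 2) := by
        ext l; ring
      rw [this, E_add, E_add, E_const_mul, E_const, h0, ih]
      ring
    simp only [iid, E_map, E_prod, List.map_cons, List.sum_cons, Nat.cast_add, Nat.cast_one, h1,
      E_add, E_const]
    ring

theorem E_iid_len (P : FinDist α) (c : PrefixCode α) (n : ℕ) :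
    (P.iid n).E c.list.len = n * (P.E c.len + 1) + 1 := by
  induction n with
  | zero => simp [iid]
  | succ n ih =>
    simp only [iid, E_map, E_prod, PrefixCode.len_list_cons, E_add, ih, E_const]
    push_cast
    ring

end FinDist

/-! ### Compressible families and their combinators -/

/-- The family `T` of functions, indexed by `θ`, has randomized prefix-free descriptions of expected
length at most `n` from which `T θ` is estimated without bias and with variance at most `V`. -/
def Compressible {Θ ι : Type} (T : Θ → ι → ℝ) (V n : ℝ) : Prop :=
  ∃ (M : Type) (c : PrefixCode M) (D : M → ι → ℝ) (P : Θ → FinDist M), ∀ θ,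
    (∀ i, (P θ).E (fun a => D a i) = T θ i ∧ (P θ).E (fun a => (D a i - T θ i) ^ 2) ≤ V) ∧
      (P θ).E c.len ≤ n

namespace Compressible

variable {Θ Θ' ι : Type} {T T' : Θ → ι → ℝ} {V V' W n n' : ℝ}

theorem mono (h : Compressible T V n) (hV : V ≤ V') (hn : n ≤ n') : Compressible T V' n' := by
  obtain ⟨M, c, D, P, h⟩ := h
  exact ⟨M, c, D, P, fun θ => ⟨fun i => ⟨((h θ).1 i).1, ((h θ).1 i).2.trans hV⟩,
    (h θ).2.trans hn⟩⟩

theorem comp (h : Compressible T V n) (g : Θ' → Θ) : Compressible (fun θ => T (g θ)) V n := by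
  obtain ⟨M, c, D, P, h⟩ := h
  exact ⟨M, c, D, fun θ => P (g θ), fun θ => h (g θ)⟩

theorem zero : Compressible (fun (_ : Θ) (_ : ι) => 0) 0 0 := by
  obtain ⟨c, hc⟩ := PrefixCode.exists_fixed Unit (b := 0) (by simp)
  exact ⟨Unit, c, fun _ _ => 0, fun _ => FinDist.pure (), fun θ => by simp [hc]⟩

theorem add (h : Compressible T V n) (h' : Compressible T' V' n') :
    Compressible (fun θ i => T θ i + T' θ i) (V + V') (n + n') := by
  obtain ⟨M, c, D, P, h⟩ := h
  obtain ⟨M', c', D', P', h'⟩ := h'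
  refine ⟨M × M', c.prod c', fun x i => D x.1 i + D' x.2 i, fun θ => (P θ).prod (P' θ),
    fun θ => ⟨fun i => ⟨?_, ?_⟩, ?_⟩⟩
  · simp [FinDist.E_add, ((h θ).1 i).1, ((h' θ).1 i).1]
  · have e : ∀ a, (P' θ).E (fun b => (D a i + D' b i - (T θ i + T' θ i)) ^ 2) =
        (D a i - T θ i) ^ 2 + (P' θ).E (fun b => (D' b i - T' θ i) ^ 2) := fun a => by
      have : (fun b => (D a i + D' b i - (T θ i + T' θ i)) ^ 2) = fun b => (D a i - T θ i) ^ 2 +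
          ((2 * (D a i - T θ i)) * (D' b i - T' θ i) + (D' b i - T' θ i) ^ 2) := by
        ext b; ring
      rw [this, FinDist.E_add, FinDist.E_add, FinDist.E_const_mul, FinDist.E_sub, FinDist.E_const,
        FinDist.E_const, ((h' θ).1 i).1]
      ring
    simp only [FinDist.E_prod, e, FinDist.E_add, FinDist.E_const]
    exact add_le_add ((h θ).1 i).2 ((h' θ).1 i).2
  · simp only [FinDist.E_prod, PrefixCode.len_prod, FinDist.E_add, FinDist.E_const]
    exact add_le_add (h θ).2 (h' θ).2

theorem const_mul (h : Compressible T V n) (s : ℝ) :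
    Compressible (fun θ i => s * T θ i) (s ^ 2 * V) n := by
  obtain ⟨M, c, D, P, h⟩ := h
  refine ⟨M, c, fun a i => s * D a i, P, fun θ => ⟨fun i => ⟨?_, ?_⟩, (h θ).2⟩⟩
  · rw [FinDist.E_const_mul, ((h θ).1 i).1]
  · simp only [← mul_sub, mul_pow, FinDist.E_const_mul]
    exact mul_le_mul_of_nonneg_left ((h θ).1 i).2 (sq_nonneg s)

/-- The second moment bounds the variance. -/
theorem of_sq {M : Type} (c : PrefixCode M) (D : M → ι → ℝ) (P : Θ → FinDist M)
    (h1 : ∀ θ i, (P θ).E (fun a => D a i) = T θ i)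
    (h2 : ∀ θ i, (P θ).E (fun a => D a i ^ 2) ≤ V) (h3 : ∀ θ, (P θ).E c.len ≤ n) :
    Compressible T V n := by
  refine ⟨M, c, D, P, fun θ => ⟨fun i => ⟨h1 θ i, ?_⟩, h3 θ⟩⟩
  rw [FinDist.E_sub_sq, h1]
  nlinarith [h2 θ i, sq_nonneg (T θ i)]

theorem E_avg_sub_sq {α : Type} (P : FinDist α) (f : α → ℝ) (k : ℕ) (hk : 1 ≤ k) :
    (P.iid k).E (fun l => ((l.map f).sum / k - P.E f) ^ 2) =
      P.E (fun a => (f a - P.E f) ^ 2) / k := by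
  have hk' : (k : ℝ) ≠ 0 := by positivity
  have : (fun l : List α => ((l.map f).sum / k - P.E f) ^ 2) =
      fun l => (1 / (k : ℝ) ^ 2) * ((l.map f).sum - k * P.E f) ^ 2 := by
    ext l; field_simp
  rw [this, FinDist.E_const_mul, FinDist.E_iid_sum_sq]
  field_simp

theorem average (h : Compressible T V n) (k : ℕ) (hk : 1 ≤ k) :
    Compressible T (V / k) (k * (n + 1) + 1) := by
  have hk' : (0 : ℝ) < k := by positivity
  obtain ⟨M, c, D, P, h⟩ := h
  refine ⟨List M, c.list, fun l i => (l.map fun a => D a i).sum / k, fun θ => (P θ).iid k,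
    fun θ => ⟨fun i => ⟨?_, ?_⟩, ?_⟩⟩
  · simp only [div_eq_inv_mul, FinDist.E_const_mul, FinDist.E_iid_sum, ((h θ).1 i).1]
    field_simp
  · have := E_avg_sub_sq (P θ) (fun a => D a i) k hk
    rw [((h θ).1 i).1] at this
    rw [this]
    exact div_le_div_of_nonneg_right ((h θ).1 i).2 hk'.le
  · rw [FinDist.E_iid_len]
    have := (h θ).2
    gcongr

/-- Send the description only with probability `q`. -/
theorem thin (h : Compressible T V n) (hW : ∀ θ i, T θ i ^ 2 ≤ W) {q : ℝ} (h0 : 0 < q)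
    (h1 : q ≤ 1) : Compressible T ((V + W) / q) (q * n + 1) := by
  obtain ⟨M, c, D, P, h⟩ := h
  obtain ⟨Q, hQ⟩ := FinDist.exists_coin false true h0.le h1
  refine of_sq c.option (fun x i => x.elim 0 fun a => D a i / q)
    (fun θ => Q.bind fun b => if b then (P θ).map some else FinDist.pure none) ?_ ?_ ?_
  · intro θ i
    simp only [FinDist.E_bind, hQ, Bool.false_eq_true, if_false, if_true, FinDist.E_pure,
      FinDist.E_map, Option.elim, div_eq_inv_mul, FinDist.E_const_mul, ((h θ).1 i).1]
    field_simp
    ring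
  · intro θ i
    have h2 := ((h θ).1 i).2
    rw [FinDist.E_sub_sq, ((h θ).1 i).1] at h2
    simp only [FinDist.E_bind, hQ, Bool.false_eq_true, if_false, if_true, FinDist.E_pure,
      FinDist.E_map, Option.elim, div_eq_inv_mul, mul_pow, FinDist.E_const_mul]
    have h3 : (P θ).E (fun a => D a i ^ 2) ≤ V + W := by nlinarith [hW θ i]
    calc _ = q⁻¹ * (P θ).E (fun a => D a i ^ 2) := by field_simp; ring
      _ ≤ _ := by gcongr
  · intro θ
    simp only [FinDist.E_bind, hQ, Bool.false_eq_true, if_false, if_true, FinDist.E_pure,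
      FinDist.E_map, PrefixCode.len_option_none, PrefixCode.len_option_some, FinDist.E_add,
      FinDist.E_const]
    nlinarith [mul_le_mul_of_nonneg_left (h θ).2 h0.le]

/-- Importance sampling: a subconvex combination of members of labelled families is described by
the label and the description of a random member. -/
theorem mixture {β J : Type} [Fintype J] {Θ : β → Type} (c : PrefixCode β)
    {T : ∀ b, Θ b → ι → ℝ} (hT : ∀ b, Compressible (T b) V n)
    (hW : ∀ b θ i, T b θ i ^ 2 ≤ W) (p : Θ' → J → ℝ) (hp : ∀ θ j, 0 ≤ p θ j)
    (hs : ∀ θ, ∑ j, p θ j ≤ 1) (e : Θ' → J → Σ b, Θ b) {l : ℝ}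
    (hl : ∀ θ j, c.len (e θ j).1 ≤ l) (hV : 0 ≤ V + W) (hn : 0 ≤ l + n) :
    Compressible (fun θ i => ∑ j, p θ j * T (e θ j).1 (e θ j).2 i) (V + W) (l + n + 1) := by
  choose M c' D P h using hT
  choose Q hQ using fun θ => FinDist.exists_of_weights (p θ) (hp θ) (hs θ)
  -- The missing mass goes to `none`, decoded as 0, so weights of sum at most 1 suffice.
  set S : Θ' → FinDist (Option (Σ b, M b)) := fun θ => (Q θ).bind fun o =>
    o.elim (FinDist.pure none) fun j => (P (e θ j).1 (e θ j).2).map fun x => some ⟨(e θ j).1, x⟩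
  have key : ∀ (θ) (f : Option (Σ b, M b) → ℝ), (S θ).E f =
      (1 - ∑ j, p θ j) * f none +
        ∑ j, p θ j * (P (e θ j).1 (e θ j).2).E fun x => f (some ⟨(e θ j).1, x⟩) := by
    intro θ f
    rw [FinDist.E_bind, hQ]
    simp
  refine of_sq (c.sigma c').option (fun x i => x.elim 0 fun y => D y.1 y.2 i) S
    (fun θ i => ?_) (fun θ i => ?_) (fun θ => ?_)
  · rw [key]
    simp only [Option.elim, mul_zero, zero_add]
    exact Finset.sum_congr rfl fun j _ => by rw [((h _ _).1 i).1]
  · rw [key]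
    simp only [Option.elim]
    calc _ ≤ (1 - ∑ j, p θ j) * 0 ^ 2 + ∑ j, p θ j * (V + W) := by
          gcongr with j
          · exact hp θ j
          have h2 := ((h _ (e θ j).2).1 i).2
          rw [FinDist.E_sub_sq, ((h _ (e θ j).2).1 i).1] at h2
          have := hW _ (e θ j).2 i
          linarith
      _ ≤ _ := by
          rw [← Finset.sum_mul]
          nlinarith [hs θ]
  · rw [key]
    simp only [PrefixCode.len_option_none, PrefixCode.len_option_some, PrefixCode.len_sigma,
      FinDist.E_add, FinDist.E_const]
    calc _ ≤ (1 - ∑ j, p θ j) * 1 + ∑ j, p θ j * (l + n + 1) := by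
          gcongr with j
          · exact hp θ j
          · exact hl θ j
          · exact (h _ (e θ j).2).2
      _ ≤ _ := by
          rw [← Finset.sum_mul]
          nlinarith [hs θ]

/-- Random signs describe small vectors. -/
theorem signs {m : ℕ} {T : Θ → Fin m → ℝ} {ε : ℝ} (hε : ∀ θ i, |T θ i| ≤ ε) :
    Compressible T (ε ^ 2) m := by
  obtain ⟨c, hc⟩ := PrefixCode.exists_fixed (Fin m → Bool) (b := m) (by simp)
  have hs : ∀ θ i, |T θ i / ε| ≤ 1 := fun θ i => by
    have h0 : 0 ≤ ε := (abs_nonneg _).trans (hε θ i)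
    rw [abs_div, abs_of_nonneg h0]
    exact div_le_one_of_le₀ (hε θ i) h0
  choose P hP using fun θ => FinDist.exists_signs _ (hs θ)
  refine of_sq c (fun b i => ε * if b i then 1 else -1) P (fun θ i => ?_) (fun θ i => ?_)
    (fun θ => ?_)
  · rw [FinDist.E_const_mul, hP]
    rcases eq_or_ne ε 0 with rfl | h
    · have := abs_nonpos_iff.1 (hε θ i)
      simp [this]
    · field_simp
  · have : (fun b : Fin m → Bool => (ε * if b i then (1 : ℝ) else -1) ^ 2) = fun _ => ε ^ 2 := by
      ext b; split_ifs <;> ring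
    rw [this, FinDist.E_const]
  · have : c.len = fun _ => (m : ℝ) := funext hc
    rw [this, FinDist.E_const]

/-- Bounded scalars are described by randomized rounding. -/
theorem scalar {s : Θ → ℝ} {Y : ℝ} (hY : ∀ θ, |s θ| ≤ Y) (b : ℕ) :
    Compressible (fun θ (_ : ι) => s θ) (1 / 4) (b + (Y + 1) / 2 ^ b + 2) := by
  obtain ⟨c, hc⟩ := PrefixCode.exists_rice b
  choose P h1 h2 h3 using fun θ => FinDist.exists_round (s θ)
  refine ⟨ℤ, c, fun z _ => z, P, fun θ => ⟨fun _ => ⟨h1 θ, ?_⟩, ?_⟩⟩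
  · rw [FinDist.E_sub_sq, h1]
    nlinarith [h2 θ]
  · refine ((P θ).E_mono hc).trans ?_
    simp only [FinDist.E_add, FinDist.E_const, div_eq_inv_mul, FinDist.E_const_mul]
    gcongr
    exact (h3 θ).trans (by linarith [hY θ])

/-- Composition with Lipschitz functions, by telescoping over averages of `4 ^ k` descriptions. -/
theorem lipschitz_comp {m : ℕ} {T : Θ → Fin m → ℝ} (h : Compressible T V n) (hn : 0 ≤ n)
    (hV : 0 ≤ V) (hT : ∀ θ i, T θ i ^ 2 ≤ V) {L : ℝ} {ψ : Fin m → ℝ → ℝ}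
    (hψ : ∀ i x y, |ψ i x - ψ i y| ≤ L * |x - y|) (h0 : ∀ i, ψ i 0 = 0) {κ : ℕ}
    (hκ : m ≤ 4 ^ κ) :
    Compressible (fun θ i => ψ i (T θ i)) ((8 * κ + 2) * (L ^ 2 * V)) (κ * (5 * n + 8) + 2) := by
  obtain ⟨M, c, D, P, h⟩ := h
  -- Level 0 uses no description at all: the empty average is 0 / 0 = 0, so F 0 = ψ 0 = 0 and the
  -- telescoping sum starts at zero. Its squared error is T ^ 2, which is why T ^ 2 ≤ V is assumed.
  set N : ℕ → ℕ := fun k => if k = 0 then 0 else 4 ^ k with hN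
  set A : ℕ → List M → Fin m → ℝ := fun k l i => (l.map fun a => D a i).sum / N k with hA
  set F : ℕ → Θ → Fin m → ℝ := fun k θ i => ((P θ).iid (N k)).E fun l => ψ i (A k l i) with hF
  have hN4 : ∀ k, (N k : ℝ) ≤ 4 ^ k := fun k => by
    rcases eq_or_ne k 0 with rfl | hk
    · simp [hN]
    · simp [hN, hk]
  have hAvar : ∀ k θ i, ((P θ).iid (N k)).E (fun l => (A k l i - T θ i) ^ 2) ≤ V / 4 ^ k := by
    intro k θ i
    rcases eq_or_ne k 0 with rfl | hk
    · simpa [hA, hN, FinDist.iid] using hT θ i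
    · have hN' : N k = 4 ^ k := by simp [hN, hk]
      have := E_avg_sub_sq (P θ) (fun a => D a i) (N k)
        (by rw [hN']; exact Nat.one_le_pow _ _ (by norm_num))
      rw [((h θ).1 i).1] at this
      simp only [hA]
      rw [this, hN']
      push_cast
      exact div_le_div_of_nonneg_right ((h θ).1 i).2 (by positivity)
  have hsq : ∀ i x y, (ψ i x - ψ i y) ^ 2 ≤ L ^ 2 * (x - y) ^ 2 := fun i x y => by
    rw [← sq_abs (ψ i x - ψ i y), ← sq_abs (x - y), ← mul_pow]
    exact pow_le_pow_left₀ (abs_nonneg _) (hψ i x y) 2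
  have hF0 : ∀ θ i, F 0 θ i = 0 := fun θ i => by simp [hF, hN, hA, FinDist.iid, h0]
  -- The second moment is at most 4 L² V / 4 ^ k and the length about 5 · 4 ^ k · n; thinning with q
  -- = 4 ^ (-k) balances both to 8 L² V and O(n), independently of k.
  have level : ∀ k, Compressible (fun θ i => F (k + 1) θ i - F k θ i) (8 * (L ^ 2 * V))
      (5 * n + 8) := by
    intro k
    have hmean : ∀ θ i, (((P θ).iid (N (k + 1))).prod ((P θ).iid (N k))).E
        (fun x => ψ i (A (k + 1) x.1 i) - ψ i (A k x.2 i)) = F (k + 1) θ i - F k θ i := by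
      intro θ i
      simp [hF, FinDist.E_sub]
    have hsqE : ∀ θ i, (((P θ).iid (N (k + 1))).prod ((P θ).iid (N k))).E
        (fun x => (ψ i (A (k + 1) x.1 i) - ψ i (A k x.2 i)) ^ 2) ≤ 4 * (L ^ 2 * V) / 4 ^ k := by
      intro θ i
      have e1 := hAvar (k + 1) θ i
      have e2 := hAvar k θ i
      have e3 : V / 4 ^ (k + 1) ≤ V / 4 ^ k :=
        div_le_div_of_nonneg_left hV (by positivity) (pow_le_pow_right₀ (by norm_num) (by omega))
      calc _ ≤ (((P θ).iid (N (k + 1))).prod ((P θ).iid (N k))).E (fun x =>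
            (2 * L ^ 2) * (A (k + 1) x.1 i - T θ i) ^ 2 + (2 * L ^ 2) * (A k x.2 i - T θ i) ^ 2) := by
            refine FinDist.E_mono _ fun x => (hsq i _ _).trans ?_
            nlinarith [mul_nonneg (sq_nonneg L)
              (sq_nonneg ((A (k + 1) x.1 i - T θ i) + (A k x.2 i - T θ i)))]
        _ = (2 * L ^ 2) * (((P θ).iid (N (k + 1))).E (fun l => (A (k + 1) l i - T θ i) ^ 2) +
            ((P θ).iid (N k)).E (fun l => (A k l i - T θ i) ^ 2)) := by
            simp only [FinDist.E_prod, FinDist.E_add, FinDist.E_const_mul, FinDist.E_const]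
            ring
        _ ≤ (2 * L ^ 2) * (V / 4 ^ k + V / 4 ^ k) := by gcongr; exact e1.trans e3
        _ = _ := by ring
    have hlev : Compressible (fun θ i => F (k + 1) θ i - F k θ i) (4 * (L ^ 2 * V) / 4 ^ k)
        (5 * 4 ^ k * (n + 1) + 2) := by
      refine of_sq (c.list.prod c.list) (fun x i => ψ i (A (k + 1) x.1 i) - ψ i (A k x.2 i)) _
        hmean hsqE fun θ => ?_
      simp only [FinDist.E_prod, PrefixCode.len_prod, FinDist.E_add, FinDist.E_const,
        FinDist.E_iid_len]
      have hl := (h θ).2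
      have hl0 : 0 ≤ (P θ).E c.len := FinDist.E_nonneg _ c.len_nonneg
      calc _ ≤ (4 ^ (k + 1) * (n + 1) + 1) + (4 ^ k * (n + 1) + 1) := by
            gcongr
            · exact hN4 _
            · exact hN4 _
        _ = _ := by ring
    have h4 : (1 : ℝ) ≤ 4 ^ k := one_le_pow₀ (by norm_num)
    refine (hlev.thin (q := 1 / 4 ^ k) (W := 4 * (L ^ 2 * V) / 4 ^ k) (fun θ i => ?_) (by positivity)
      (by rw [div_le_one (by positivity)]; exact h4)).mono (le_of_eq ?_) ?_
    · rw [← hmean]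
      exact (FinDist.sq_E_le _ _).trans (hsqE θ i)
    · field_simp; ring
    · have : 1 / (4 : ℝ) ^ k * 2 ≤ 2 := by
        rw [div_mul_eq_mul_div, div_le_iff₀ (by positivity)]; linarith
      have e : 1 / (4 : ℝ) ^ k * (5 * 4 ^ k * (n + 1)) = 5 * (n + 1) := by field_simp
      rw [mul_add, e]
      linarith
  have sum : ∀ K : ℕ, Compressible (F K) (8 * K * (L ^ 2 * V)) (K * (5 * n + 8)) := by
    intro K
    induction K with
    | zero =>
      have : F 0 = fun _ _ => 0 := funext fun θ => funext fun i => hF0 θ i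
      rw [this]
      simpa using zero
    | succ K ih =>
      have := ih.add (level K)
      simp only [add_sub_cancel] at this
      exact this.mono (le_of_eq (by push_cast; ring)) (le_of_eq (by push_cast; ring))
  -- The bias left after κ levels is at most the root mean square error of an average of 4 ^ κ
  -- descriptions, times L.
  have hlast : ∀ θ i, |ψ i (T θ i) - F κ θ i| ≤ Real.sqrt (L ^ 2 * V / 4 ^ κ) := by
    intro θ i
    refine Real.abs_le_sqrt ?_
    have e : ψ i (T θ i) - F κ θ i =
        ((P θ).iid (N κ)).E fun l => ψ i (T θ i) - ψ i (A κ l i) := by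
      rw [FinDist.E_sub, FinDist.E_const]
    rw [e]
    refine (FinDist.sq_E_le _ _).trans ?_
    calc _ ≤ ((P θ).iid (N κ)).E (fun l => L ^ 2 * (A κ l i - T θ i) ^ 2) :=
          FinDist.E_mono _ fun l => (hsq i _ _).trans (le_of_eq (by ring))
      _ ≤ L ^ 2 * (V / 4 ^ κ) := by
          rw [FinDist.E_const_mul]; gcongr; exact hAvar κ θ i
      _ = _ := by ring
  have h4 : (1 : ℝ) ≤ 4 ^ κ := one_le_pow₀ (by norm_num)
  have hfin := (signs hlast).thin (q := 1 / 4 ^ κ) (W := L ^ 2 * V / 4 ^ κ)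
    (fun θ i => by
      have := pow_le_pow_left₀ (abs_nonneg _) (hlast θ i) 2
      rwa [sq_abs, Real.sq_sqrt (by positivity)] at this)
    (by positivity) (by rw [div_le_one (by positivity)]; exact h4)
  rw [Real.sq_sqrt (by positivity)] at hfin
  have := (sum κ).add hfin
  simp only [add_sub_cancel] at this
  refine this.mono (le_of_eq (by field_simp; ring)) ?_
  have hm : (m : ℝ) ≤ 4 ^ κ := by exact_mod_cast hκ
  have : 1 / (4 : ℝ) ^ κ * m ≤ 1 := by
    rw [div_mul_eq_mul_div, div_le_iff₀ (by positivity)]; linarith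
  linarith

end Compressible

/-! ### From finite distributions to compressors -/

namespace FinDist

variable {α : Type}

/-- The measure of a finitely supported distribution. -/
def toMeasure [MeasurableSpace α] (P : FinDist α) : Measure α :=
  ∑ a ∈ P.w.support, ENNReal.ofReal (P.w a) • Measure.dirac a

instance [MeasurableSpace α] (P : FinDist α) : IsProbabilityMeasure P.toMeasure where
  measure_univ := by
    have h := P.total
    rw [Finsupp.sum] at h
    simp only [toMeasure, Measure.coe_finsetSum, Finset.sum_apply, Measure.smul_apply,
      measure_univ, smul_eq_mul, mul_one]
    rw [← ENNReal.ofReal_sum_of_nonneg fun a _ => P.nonneg a, h, ENNReal.ofReal_one]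

variable [MeasurableSpace α] [DiscreteMeasurableSpace α]

theorem integrable_toMeasure (P : FinDist α) (f : α → ℝ) : Integrable f P.toMeasure :=
  integrable_finsetSum_measure.2 fun _ _ =>
    (integrable_dirac (by simp)).smul_measure ENNReal.ofReal_ne_top

theorem integral_toMeasure (P : FinDist α) (f : α → ℝ) : ∫ a, f a ∂P.toMeasure = P.E f := by
  rw [toMeasure, integral_finsetSum_measure
    (integrable_finsetSum_measure.1 (P.integrable_toMeasure f)), E_eq]
  refine Finset.sum_congr rfl fun a _ => ?_
  rw [integral_smul_measure, integral_dirac, ENNReal.toReal_ofReal (P.nonneg a), smul_eq_mul]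

theorem memLp_toMeasure (P : FinDist α) (f : α → ℝ) : MemLp f 2 P.toMeasure :=
  (memLp_two_iff_integrable_sq Measurable.of_discrete.aestronglyMeasurable).2
    (P.integrable_toMeasure _)

theorem lintegral_toMeasure (P : FinDist α) (f : α → ℕ) :
    ∫⁻ a, (f a : ℝ≥0∞) ∂P.toMeasure = ENNReal.ofReal (P.E fun a => f a) := by
  rw [← integral_toMeasure, ofReal_integral_eq_lintegral_ofReal (P.integrable_toMeasure _)
    (Filter.Eventually.of_forall fun a => Nat.cast_nonneg _)]
  simp

end FinDist

/-- One sample space must serve every member of the class, so it is the product over all members,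
each coordinate carrying its own message distribution. Only the marginals matter, and the decoder
needs only injectivity of the code. -/
theorem Compressible.compressor {m : ℕ} {H : Set (Fin m → ℝ)} {n : ℝ}
    (h : Compressible (fun f : H => f.1) 1 n) : Nonempty (Compressor H 1 n) := by
  obtain ⟨M, c, D, P, h⟩ := h
  let mM : MeasurableSpace M := ⊤
  have hM : DiscreteMeasurableSpace M := ⟨fun _ => trivial⟩
  let μ : Measure (H → M) := Measure.infinitePi fun f => (P f).toMeasure
  have hμ : ∀ f : H, MeasurePreserving (Function.eval f) μ (P f).toMeasure :=
    measurePreserving_eval_infinitePi fun f => (P f).toMeasure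
  have hint : ∀ (f : H) (g : M → ℝ), ∫ ω, g (ω f) ∂μ = (P f).E g := fun f g => by
    rw [← FinDist.integral_toMeasure, ← (hμ f).map_eq, integral_map (hμ f).measurable.aemeasurable
      Measurable.of_discrete.aestronglyMeasurable]
  have hD : ∀ a, Function.extend c.enc D (fun _ _ => 0) (c.enc a) = D a := fun a =>
    c.injective.extend_apply _ _ _
  refine ⟨⟨H → M, inferInstance, μ, inferInstance, fun ω f => (c.enc (ω f)).length,
    fun ω f => c.enc (ω f), Function.extend c.enc D fun _ _ => 0, fun f s => ?_, fun _ _ => rfl,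
    fun f i => ⟨?_, ?_, fun u hu => ?_⟩, fun f => ?_⟩⟩
  · exact (hμ f).measurable (MeasurableSet.of_discrete (s := {a | c.enc a = s}))
  · simp only [hD]
    exact ((P f).memLp_toMeasure fun a => D a i).comp_measurePreserving (hμ f)
  · simp only [hD]
    rw [hint f fun a => D a i]
    exact ((h f).1 i).1
  · simp only [hD]
    have hmeas : Measurable fun ω : H → M => (inner ℝ u (D (ω f) i) : ℝ) :=
      (Measurable.of_discrete (f := fun a => (inner ℝ u (D a i) : ℝ))).comp (hμ f).measurable
    rw [ProbabilityTheory.variance_eq_integral hmeas.aemeasurable, hint f fun a => (inner ℝ u (D a i) : ℝ),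
      hint f fun a => ((inner ℝ u (D a i) : ℝ) - (P f).E fun a => (inner ℝ u (D a i) : ℝ)) ^ 2]
    have hu2 : u ^ 2 = 1 := by rw [← sq_abs, ← Real.norm_eq_abs, hu, one_pow]
    have e : ∀ a, (inner ℝ u (D a i) : ℝ) = u * D a i := fun a => by
      simp [mul_comm]
    simp only [e, FinDist.E_const_mul, ← mul_sub, mul_pow, hu2, one_mul, ((h f).1 i).1]
    simpa using ((h f).1 i).2
  · have := (hμ f).lintegral_comp (f := fun a => ((c.enc a).length : ℝ≥0∞))
      Measurable.of_discrete
    simp only [Function.eval] at this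
    rw [this, FinDist.lintegral_toMeasure]
    exact ENNReal.ofReal_le_ofReal (h f).2

/-! ### Sketches of vectors and neurons -/

namespace Compressible

/-- Linear functionals of bounded norm are described by a random coordinate and a rounded value. -/
theorem sketch {d m : ℕ} (hd : 1 ≤ d) (x : Fin m → EuclideanSpace ℝ (Fin d)) {ρ B : ℝ} (hρ : 0 < ρ)
    (hB : ∀ i, ‖x i‖ ≤ B) {b : ℕ} (hb : d ≤ 2 ^ b) :
    Compressible (fun (u : {u : EuclideanSpace ℝ (Fin d) // ‖u‖ ≤ ρ}) i => inner ℝ u.1 (x i))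
      (3 * ρ ^ 2 * B ^ 2) (2 * b + 6) := by
  have hd' : (1 : ℝ) ≤ d := by exact_mod_cast hd
  have hb' : (d : ℝ) ≤ 2 ^ b := by exact_mod_cast hb
  obtain ⟨cf, hcf⟩ := PrefixCode.exists_fixed (Fin d) (b := b) (by simpa using hb)
  obtain ⟨cr, hcr⟩ := PrefixCode.exists_rice b
  -- The part proportional to u j ^ 2 bounds the second moment; the uniform part keeps p at least 1
  -- / (2 d), hence the value to be rounded at most 2 d and its Rice code at O(log d) bits.
  set p : EuclideanSpace ℝ (Fin d) → Fin d → ℝ := fun u j => u j ^ 2 / (2 * ρ ^ 2) + 1 / (2 * d)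
    with hp
  have hp1 : ∀ u j, 1 / (2 * d) ≤ p u j := fun u j => by
    simp only [hp, le_add_iff_nonneg_left]; positivity
  have hp0 : ∀ u j, 0 < p u j := fun u j => (by positivity : (0 : ℝ) < 1 / (2 * d)).trans_le (hp1 u j)
  have hps : ∀ u : {u : EuclideanSpace ℝ (Fin d) // ‖u‖ ≤ ρ}, ∑ j, p u.1 j ≤ 1 := fun u => by
    have hu : ∑ j, u.1 j ^ 2 ≤ ρ ^ 2 := by
      rw [← EuclideanSpace.real_norm_sq_eq]
      exact pow_le_pow_left₀ (norm_nonneg _) u.2 2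
    simp only [hp, Finset.sum_add_distrib, ← Finset.sum_div, Finset.sum_const, Finset.card_univ,
      Fintype.card_fin, nsmul_eq_mul]
    have h1 : (∑ j, u.1 j ^ 2) / (2 * ρ ^ 2) ≤ 1 / 2 := by
      rw [div_le_div_iff₀ (by positivity) (by norm_num)]; linarith
    have h2 : (d : ℝ) * 1 / (2 * d) = 1 / 2 := by field_simp
    linarith
  have hpj : ∀ (u : {u : EuclideanSpace ℝ (Fin d) // ‖u‖ ≤ ρ}) j, p u.1 j ≤ 1 := fun u j =>
    (Finset.single_le_sum (fun j _ => (hp0 u.1 j).le) (Finset.mem_univ j)).trans (hps u)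
  have huj : ∀ (u : {u : EuclideanSpace ℝ (Fin d) // ‖u‖ ≤ ρ}) j, |u.1 j| ≤ ρ := fun u j =>
    (PiLp.norm_apply_le u.1 j).trans u.2
  choose Q hQ using fun u : {u : EuclideanSpace ℝ (Fin d) // ‖u‖ ≤ ρ} =>
    FinDist.exists_of_weights (p u.1) (fun j => (hp0 u.1 j).le) (hps u)
  choose Z hZ1 hZ2 hZ3 using FinDist.exists_round
  set S : {u : EuclideanSpace ℝ (Fin d) // ‖u‖ ≤ ρ} → FinDist (Option (Fin d × ℤ)) := fun u =>
    (Q u).bind fun o => o.elim (FinDist.pure none) fun j =>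
      (Z (u.1 j / (p u.1 j * ρ))).map fun z => some (j, z)
  have key : ∀ u f, (S u).E f = (1 - ∑ j, p u.1 j) * f none +
      ∑ j, p u.1 j * (Z (u.1 j / (p u.1 j * ρ))).E fun z => f (some (j, z)) := by
    intro u f
    rw [FinDist.E_bind, hQ]
    simp
  refine of_sq (cf.prod cr).option (fun o i => o.elim 0 fun y => (ρ * x i y.1) * y.2) S
    (fun u i => ?_) (fun u i => ?_) (fun u => ?_)
  · rw [key]
    simp only [Option.elim, mul_zero, zero_add, FinDist.E_const_mul, hZ1]
    rw [PiLp.inner_apply]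
    refine Finset.sum_congr rfl fun j _ => ?_
    have := (hp0 u.1 j).ne'
    simp
    field_simp
  · rw [key]
    simp only [Option.elim, mul_pow, FinDist.E_const_mul]
    have hx : ∑ j, x i j ^ 2 ≤ B ^ 2 := by
      rw [← EuclideanSpace.real_norm_sq_eq]
      exact pow_le_pow_left₀ (norm_nonneg _) (hB i) 2
    calc _ ≤ (1 - ∑ j, p u.1 j) * 0 ^ 2 + ∑ j, 3 * ρ ^ 2 * x i j ^ 2 := by
          refine add_le_add (by simp) (Finset.sum_le_sum fun j _ => ?_)
          have h0 := hp0 u.1 j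
          have h1 : p u.1 j * (u.1 j / (p u.1 j * ρ)) ^ 2 ≤ 2 := by
            have : p u.1 j * (u.1 j / (p u.1 j * ρ)) ^ 2 = u.1 j ^ 2 / (p u.1 j * ρ ^ 2) := by
              field_simp
            rw [this, div_le_iff₀ (by positivity)]
            have : p u.1 j * ρ ^ 2 = u.1 j ^ 2 / 2 + ρ ^ 2 / (2 * d) := by
              simp only [hp]; field_simp
            rw [this]
            have : 0 ≤ ρ ^ 2 / (2 * d) := by positivity
            linarith
          calc _ ≤ p u.1 j * (ρ ^ 2 * x i j ^ 2 * ((u.1 j / (p u.1 j * ρ)) ^ 2 + 1 / 4)) := by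
                gcongr
                exact hZ2 _
            _ = ρ ^ 2 * x i j ^ 2 * (p u.1 j * (u.1 j / (p u.1 j * ρ)) ^ 2 + p u.1 j / 4) := by ring
            _ ≤ ρ ^ 2 * x i j ^ 2 * 3 := by
                gcongr
                have := hpj u j
                linarith
            _ = _ := by ring
      _ = 3 * ρ ^ 2 * ∑ j, x i j ^ 2 := by rw [← Finset.mul_sum]; ring
      _ ≤ _ := by gcongr
  · rw [key]
    simp only [PrefixCode.len_option_none, PrefixCode.len_option_some, PrefixCode.len_prod,
      FinDist.E_add, FinDist.E_const, hcf]
    have hlen : ∀ j, (Z (u.1 j / (p u.1 j * ρ))).E cr.len ≤ b + 5 := by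
      intro j
      refine (FinDist.E_mono _ hcr).trans ?_
      simp only [FinDist.E_add, FinDist.E_const, div_eq_inv_mul, FinDist.E_const_mul]
      have h0 := hp0 u.1 j
      have h1 : |(p u.1 j * ρ)⁻¹ * u.1 j| ≤ 2 * d := by
        rw [abs_mul, abs_of_pos (by positivity), inv_mul_le_iff₀ (by positivity)]
        have := hp1 u.1 j
        rw [div_le_iff₀ (by positivity)] at this
        calc |u.1 j| ≤ 1 * ρ := by simpa using huj u j
          _ ≤ (p u.1 j * (2 * d)) * ρ := by gcongr
          _ = _ := by ring
      have h2 := hZ3 ((p u.1 j * ρ)⁻¹ * u.1 j)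
      have h3 : ((2 : ℝ) ^ b)⁻¹ * (Z ((p u.1 j * ρ)⁻¹ * u.1 j)).E (fun z => |(z : ℝ)|) ≤ 3 := by
        rw [inv_mul_le_iff₀ (by positivity)]
        linarith
      linarith
    calc _ ≤ (1 - ∑ j, p u.1 j) * (2 * b + 6) + ∑ j, p u.1 j * (b + (b + 5) + 1) := by
          have hb0 : (0 : ℝ) ≤ b := Nat.cast_nonneg b
          refine add_le_add (mul_le_mul_of_nonneg_left (by linarith) (by linarith [hps u]))
            (Finset.sum_le_sum fun j _ => mul_le_mul_of_nonneg_left ?_ (hp0 u.1 j).le)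
          linarith [hlen j]
      _ = _ := by rw [← Finset.sum_mul]; ring

/-- A single neuron with weights in a ball around its initialization. -/
theorem neuron {d m : ℕ} (hd : 1 ≤ d) (x : Fin m → EuclideanSpace ℝ (Fin d)) {ρ B : ℝ} (hρ : 0 < ρ)
    (hB : ∀ i, ‖x i‖ ≤ B) {b : ℕ} (hb : d ≤ 2 ^ b) {L : ℝ} {ψ : Fin m → ℝ → ℝ}
    (hψ : ∀ i x y, |ψ i x - ψ i y| ≤ L * |x - y|) (h0 : ∀ i, ψ i 0 = 0) {κ : ℕ}
    (hκ : m ≤ 4 ^ κ) :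
    Compressible (fun (u : {u : EuclideanSpace ℝ (Fin d) // ‖u‖ ≤ ρ}) i =>
      ψ i (inner ℝ u.1 (x i))) (24 * (L ^ 2 * ρ ^ 2 * B ^ 2)) ((κ + 1) ^ 2 * (10 * b + 42)) := by
  -- Averaging κ + 1 copies cancels the factor 8 κ + 2 in the variance, at the price of a second
  -- factor κ + 1 in the length.
  have h1 := (((sketch hd x hρ hB hb).lipschitz_comp (by positivity) (by positivity)
    (fun u i => ?_) hψ h0 hκ).average (κ + 1) (by omega))
  · refine h1.mono ?_ ?_
    · push_cast
      rw [div_le_iff₀ (by positivity)]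
      nlinarith [(by positivity : 0 ≤ L ^ 2 * ρ ^ 2 * B ^ 2)]
    · push_cast
      have : (0 : ℝ) ≤ κ := Nat.cast_nonneg κ
      have : (0 : ℝ) ≤ b := Nat.cast_nonneg b
      have : (0 : ℝ) ≤ κ * b := by positivity
      nlinarith
  · have hx : |inner ℝ u.1 (x i)| ≤ ρ * B :=
      (abs_real_inner_le_norm _ _).trans (mul_le_mul u.2 (hB i) (norm_nonneg _) hρ.le)
    have := pow_le_pow_left₀ (abs_nonneg _) hx 2
    rw [sq_abs] at this
    nlinarith [(by positivity : 0 ≤ ρ ^ 2 * B ^ 2)]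

end Compressible

/-- Take the least admissible exponent: if it is 0 the scale is s, otherwise minimality gives a
scale of at most 2 y. -/
theorem exists_dyadic_scale {s y : ℝ} (hs : 0 < s) {b : ℕ} (h : y ≤ s * 2 ^ b) :
    ∃ a ≤ b, y ≤ s * 2 ^ a ∧ (s * 2 ^ a) ^ 2 ≤ s ^ 2 + 4 * y ^ 2 := by
  classical
  have hex : ∃ a, y ≤ s * 2 ^ a := ⟨b, h⟩
  refine ⟨Nat.find hex, Nat.find_min' hex h, Nat.find_spec hex, ?_⟩
  rcases h' : Nat.find hex with _ | a
  · simp; positivity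
  · have := Nat.find_min hex (m := a) (by omega)
    push Not at this
    have h2 : s * 2 ^ (a + 1) ≤ 2 * y := by rw [pow_succ]; linarith
    nlinarith [pow_le_pow_left₀ (by positivity) h2 2, sq_nonneg s]

/-- A linear combination of neurons, by importance sampling. -/
theorem Compressible.neurons {d t m : ℕ} (hd : 1 ≤ d) (ht : 1 ≤ t)
    (x : Fin m → EuclideanSpace ℝ (Fin d)) {R r B : ℝ} (hR : 0 < R) (hr : 0 < r)
    (hB : ∀ i, ‖x i‖ ≤ B) {b bt : ℕ} (hb : d ≤ 2 ^ b) (hbt : t ≤ 2 ^ bt) {L : ℝ}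
    {ψ : Fin t → Fin m → ℝ → ℝ} (hψ : ∀ j i x y, |ψ j i x - ψ j i y| ≤ L * |x - y|)
    (h0 : ∀ j i, ψ j i 0 = 0) {κ : ℕ} (hκ : m ≤ 4 ^ κ) :
    Compressible (fun (θ : {θ : (Fin t → EuclideanSpace ℝ (Fin d)) × EuclideanSpace ℝ (Fin t) //
      ∑ j, ‖θ.1 j‖ ^ 2 ≤ R ^ 2 ∧ ‖θ.2‖ ≤ r}) i =>
        ∑ j, θ.1.2 j * ψ j i (inner ℝ (θ.1.1 j) (x i)))
      (225 * (L ^ 2 * B ^ 2 * R ^ 2 * r ^ 2)) (2 * bt + 3 + (κ + 1) ^ 2 * (10 * b + 42)) := by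
  have ht' : (1 : ℝ) ≤ t := by exact_mod_cast ht
  have hst : 0 < Real.sqrt t := Real.sqrt_pos.2 (by linarith)
  -- With this smallest scale, rounding up tiny rows adds at most t · s² = R² to the sum of squared
  -- scales, and exponents up to `bt` reach R.
  set s : ℝ := R / Real.sqrt t with hs
  have hs0 : 0 < s := by positivity
  set S : ℝ := 3 * R * r with hS
  have hS0 : 0 < S := by positivity
  have hRb : R ≤ s * 2 ^ bt := by
    rw [hs, div_mul_eq_mul_div, le_div_iff₀ hst]
    have h1 : Real.sqrt t ≤ t := by
      rw [Real.sqrt_le_left (by linarith)]; nlinarith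
    have h2 : (t : ℝ) ≤ 2 ^ bt := by exact_mod_cast hbt
    exact mul_le_mul_of_nonneg_left (h1.trans h2) hR.le
  have hle : ∀ (θ : {θ : (Fin t → EuclideanSpace ℝ (Fin d)) × EuclideanSpace ℝ (Fin t) //
      ∑ j, ‖θ.1 j‖ ^ 2 ≤ R ^ 2 ∧ ‖θ.2‖ ≤ r}) j, ‖θ.1.1 j‖ ≤ R := fun θ j =>
    pow_le_pow_iff_left₀ (norm_nonneg _) hR.le two_ne_zero |>.1
      ((Finset.single_le_sum (f := fun j => ‖θ.1.1 j‖ ^ 2) (fun j _ => sq_nonneg _)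
        (Finset.mem_univ j)).trans θ.2.1)
  choose a ha1 ha2 ha3 using fun θ j =>
    exists_dyadic_scale hs0 ((hle θ j).trans hRb)
  obtain ⟨ct, hct⟩ := PrefixCode.exists_fixed (Fin t) (b := bt) (by simpa using hbt)
  obtain ⟨cu, hcu⟩ := PrefixCode.exists_unary
  obtain ⟨cb, hcb⟩ := PrefixCode.exists_fixed Bool (b := 1) (by simp)
  -- The label holds the neuron, the scale exponent and the sign of its output weight. Dividing by
  -- the scale makes the variance the same for all labels.
  have hT : ∀ β : Fin t × ℕ × Bool, Compressible
      (fun (u : {u : EuclideanSpace ℝ (Fin d) // ‖u‖ ≤ s * 2 ^ β.2.1}) i =>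
        ((if β.2.2 then 1 else -1) * S / (s * 2 ^ β.2.1)) * ψ β.1 i (inner ℝ u.1 (x i)))
      (24 * (L ^ 2 * B ^ 2 * S ^ 2)) ((κ + 1) ^ 2 * (10 * b + 42)) := fun β => by
    refine ((neuron hd x (by positivity) hB hb (hψ β.1) (h0 β.1) hκ).const_mul _).mono
      (le_of_eq ?_) le_rfl
    split_ifs <;> field_simp
  have hW : ∀ (β : Fin t × ℕ × Bool)
      (u : {u : EuclideanSpace ℝ (Fin d) // ‖u‖ ≤ s * 2 ^ β.2.1}) (i : Fin m),
      (((if β.2.2 then 1 else -1) * S / (s * 2 ^ β.2.1)) * ψ β.1 i (inner ℝ u.1 (x i))) ^ 2 ≤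
        L ^ 2 * B ^ 2 * S ^ 2 := fun β u i => by
    have hbd : ∀ ρ > 0, ∀ v : EuclideanSpace ℝ (Fin d), ‖v‖ ≤ ρ →
        (((if β.2.2 then 1 else -1) * S / ρ) * ψ β.1 i (inner ℝ v (x i))) ^ 2 ≤
          L ^ 2 * B ^ 2 * S ^ 2 := by
      intro ρ hρ v hv
      have h1 : (ψ β.1 i (inner ℝ v (x i))) ^ 2 ≤ L ^ 2 * (ρ * B) ^ 2 := by
        have h2 := hψ β.1 i (inner ℝ v (x i)) 0
        rw [h0, sub_zero, sub_zero] at h2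
        have h3 := pow_le_pow_left₀ (abs_nonneg _) h2 2
        rw [sq_abs, mul_pow] at h3
        refine h3.trans (mul_le_mul_of_nonneg_left (pow_le_pow_left₀ (abs_nonneg _) ?_ 2)
          (sq_nonneg L))
        exact (abs_real_inner_le_norm _ _).trans (mul_le_mul hv (hB i) (norm_nonneg _) hρ.le)
      have h2 : ((if β.2.2 then (1 : ℝ) else -1) * S / ρ) ^ 2 = (S / ρ) ^ 2 := by
        split_ifs <;> ring
      rw [mul_pow, h2]
      calc _ ≤ (S / ρ) ^ 2 * (L ^ 2 * (ρ * B) ^ 2) := by gcongr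
        _ = _ := by field_simp
    exact hbd _ (by positivity) u.1 u.2
  -- Cauchy–Schwarz bounds the weighted sum of scales by √5 · R r, below S = 3 R r.
  have hsum : ∀ (θ : {θ : (Fin t → EuclideanSpace ℝ (Fin d)) × EuclideanSpace ℝ (Fin t) //
      ∑ j, ‖θ.1 j‖ ^ 2 ≤ R ^ 2 ∧ ‖θ.2‖ ≤ r}), ∑ j, |θ.1.2 j| * (s * 2 ^ a θ j) / S ≤ 1 := by
    intro θ
    rw [← Finset.sum_div, div_le_one hS0]
    have h1 := Finset.sum_mul_sq_le_sq_mul_sq Finset.univ (fun j => |θ.1.2 j|)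
      fun j => s * 2 ^ a θ j
    have h2 : ∑ j, |θ.1.2 j| ^ 2 ≤ r ^ 2 := by
      simp only [sq_abs]
      rw [← EuclideanSpace.real_norm_sq_eq]
      exact pow_le_pow_left₀ (norm_nonneg _) θ.2.2 2
    have h3 : ∑ j, (s * 2 ^ a θ j) ^ 2 ≤ 5 * R ^ 2 := by
      calc _ ≤ ∑ j, (s ^ 2 + 4 * ‖θ.1.1 j‖ ^ 2) := Finset.sum_le_sum fun j _ => ha3 θ j
        _ = t * s ^ 2 + 4 * ∑ j, ‖θ.1.1 j‖ ^ 2 := by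
          rw [Finset.sum_add_distrib, ← Finset.mul_sum]; simp
        _ ≤ R ^ 2 + 4 * R ^ 2 := by
          refine add_le_add (le_of_eq ?_) (by linarith [θ.2.1])
          rw [hs, div_pow, Real.sq_sqrt (by linarith)]
          field_simp
        _ = _ := by ring
    refine abs_le_of_sq_le_sq' (h1.trans ?_) hS0.le |>.2
    calc _ ≤ r ^ 2 * (5 * R ^ 2) :=
          mul_le_mul h2 h3 (Finset.sum_nonneg fun _ _ => sq_nonneg _) (sq_nonneg _)
      _ ≤ _ := by rw [hS]; nlinarith [(by positivity : 0 ≤ r ^ 2 * R ^ 2)]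
  have := mixture (ct.prod (cu.prod cb)) hT hW (fun θ j => |θ.1.2 j| * (s * 2 ^ a θ j) / S)
    (fun θ j => by positivity) hsum
    (fun θ j => ⟨(j, a θ j, decide (0 ≤ θ.1.2 j)), ⟨θ.1.1 j, ha2 θ j⟩⟩) (l := 2 * bt + 2)
    (fun θ j => by
      have h1 : (a θ j : ℝ) ≤ bt := by exact_mod_cast ha1 θ j
      simp only [PrefixCode.len_prod, hct, hcu, hcb]
      push_cast
      linarith) (by positivity) (by positivity)
  convert this using 1
  · funext θ i
    refine Finset.sum_congr rfl fun j _ => ?_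
    have hρ : 0 < s * 2 ^ a θ j := by positivity
    rcases le_or_gt 0 (θ.1.2 j) with h | h
    · simp only [h, decide_true, if_true, abs_of_nonneg]
      field_simp
    · simp only [not_le.2 h, decide_false, Bool.false_eq_true, if_false, abs_of_neg h]
      field_simp
  -- 225 = (24 + 1) · 3²: variance plus squared mean, times the square from S.
  · rw [hS]; ring
  · ring

/-! ### Two-layer networks -/

namespace Compressible

variable {Θ ι : Type} {T : Θ → ι → ℝ} {V n : ℝ}

/-- Buys variance 1 / q with about q V copies; the extra copy keeps the number positive when V = 0.
-/
theorem average_of_pos (h : Compressible T V n) (hV : 0 ≤ V) (hn : 0 ≤ n) {q : ℝ} (hq : 0 < q) :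
    Compressible T (1 / q) ((q * V + 2) * (n + 1) + 1) := by
  have h1 : q * V ≤ (⌈q * V⌉₊ + 1 : ℕ) := (Nat.le_ceil _).trans (by push_cast; linarith)
  have h2 : ((⌈q * V⌉₊ + 1 : ℕ) : ℝ) ≤ q * V + 2 := by
    push_cast
    linarith [Nat.ceil_lt_add_one (by positivity : 0 ≤ q * V)]
  refine (h.average (⌈q * V⌉₊ + 1) (by omega)).mono ?_ (by gcongr)
  rw [div_le_div_iff₀ (by positivity) hq]
  linarith

end Compressible

theorem clog_two_le {n : ℕ} (hn : 1 ≤ n) : (Nat.clog 2 n : ℝ) ≤ Real.logb 2 n + 1 := by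
  have h : 0 ≤ Real.logb 2 (n : ℝ) := Real.logb_nonneg (by norm_num) (by exact_mod_cast hn)
  have e : Nat.clog 2 n = ⌈Real.logb 2 (n : ℝ)⌉₊ := by
    have := Real.natCeil_logb_natCast 2 n
    exact_mod_cast this.symm
  rw [e]
  exact (Nat.ceil_lt_add_one h).le

/-- The description length of the three parts of a network is dominated by the bound claimed for
the class. -/
theorem length_le {K c X Z lg ld lm lr lt b bt κ b' : ℝ} (hK : 0 ≤ K) (hc : 0 < c)
    (hX : c ^ 2 ≤ X) (hZ : Z ≤ (K + 1) ^ 2 * K ^ 2 / c ^ 2 * X) (hld : 1 ≤ ld) (hlm : 0 ≤ lm)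
    (hlg : lg = ld + lm) (hlr : 0 ≤ lr) (hlt : 0 ≤ lt) (hb : b ≤ ld + 1)
    (hbt0 : 0 ≤ bt) (hbt : bt ≤ lt + 1) (hκ0 : 0 ≤ κ) (hκ : κ ≤ lm + 1) (hb' : b' ≤ lr + lt + 1) :
    (b' + (K * (K + 1) + 1) + 2) + ((4 * (3 * Z) + 2) * (2 * bt + 6 + 1) + 1) +
      ((2 * (225 * ((K + 1) ^ 2 * X)) + 2) * (2 * bt + 3 + (κ + 1) ^ 2 * (10 * b + 42) + 1) + 1) ≤
    ((541 + K * (K + 1)) / c ^ 2 + 132 * ((K + 1) ^ 2 * K ^ 2 / c ^ 2) + 115200 * (K + 1) ^ 2) *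
      (X * (lg ^ 2 * ld + lr + lt)) := by
  have hX0 : 0 < X := (by positivity : 0 < c ^ 2).trans_le hX
  have hlg1 : 1 ≤ lg := by linarith
  have hmain : 1 ≤ lg ^ 2 * ld := one_le_mul_of_one_le_of_one_le (one_le_pow₀ hlg1) hld
  set G := lg ^ 2 * ld + lr + lt with hG
  have hG1 : 1 ≤ G := by linarith
  have h1 : b' + (K * (K + 1) + 1) + 2 ≤ (5 + K * (K + 1)) * G := by
    nlinarith [mul_le_mul_of_nonneg_left hG1 (by positivity : 0 ≤ K * (K + 1))]
  have h2 : 2 * bt + 6 + 1 ≤ 11 * G := by linarith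
  have h3 : (κ + 1) ^ 2 * (10 * b + 42) ≤ 248 * (lg ^ 2 * ld) := by
    have e1 : (κ + 1) ^ 2 ≤ (2 * lg) ^ 2 := pow_le_pow_left₀ (by linarith) (by linarith) 2
    calc (κ + 1) ^ 2 * (10 * b + 42) ≤ (κ + 1) ^ 2 * (62 * ld) := by gcongr; linarith
      _ ≤ (2 * lg) ^ 2 * (62 * ld) := by gcongr
      _ = _ := by ring
  have h4 : 2 * bt + 3 + (κ + 1) ^ 2 * (10 * b + 42) + 1 ≤ 256 * G := by linarith
  set A := (K + 1) ^ 2 * K ^ 2 / c ^ 2 with hA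
  have hA0 : 0 ≤ A := by positivity
  have h5 : (4 * (3 * Z) + 2) * (2 * bt + 6 + 1) ≤ (12 * (A * X) + 2) * (11 * G) :=
    mul_le_mul (by linarith) h2 (by linarith) (by positivity)
  have h6 : (2 * (225 * ((K + 1) ^ 2 * X)) + 2) *
      (2 * bt + 3 + (κ + 1) ^ 2 * (10 * b + 42) + 1) ≤
      (2 * (225 * ((K + 1) ^ 2 * X)) + 2) * (256 * G) := by gcongr
  -- The terms without a factor X are absorbed through X ≥ c².
  have h7 : (541 + K * (K + 1)) * G ≤ (541 + K * (K + 1)) / c ^ 2 * X * G := by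
    gcongr
    rw [div_mul_eq_mul_div, le_div_iff₀ (by positivity)]
    gcongr
  calc _ ≤ (5 + K * (K + 1)) * G + ((12 * (A * X) + 2) * (11 * G) + G) +
        ((2 * (225 * ((K + 1) ^ 2 * X)) + 2) * (256 * G) + G) := by linarith
    _ = (541 + K * (K + 1)) * G + (132 * A * X + 115200 * (K + 1) ^ 2 * X) * G := by ring
    _ ≤ (541 + K * (K + 1)) / c ^ 2 * X * G +
        (132 * A * X + 115200 * (K + 1) ^ 2 * X) * G := by gcongr
    _ = _ := by ring

/-- The three parts of a two-layer network: the constant `⟨v, σ 0⟩`, the linear part `⟨v, y i⟩`, and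
the change of the neurons from their initialization. -/
theorem Compressible.network {d t m : ℕ} (hd : 2 ≤ d) (ht : 1 ≤ t) (hm : 1 ≤ m)
    (x : Fin m → EuclideanSpace ℝ (Fin d)) (y : Fin m → EuclideanSpace ℝ (Fin t))
    (z : EuclideanSpace ℝ (Fin t)) {K c L B R r : ℝ} (hK : 0 ≤ K) (hc : 0 < c)
    (hr : 1 ≤ r) (hR : c ≤ R) (hX : c ≤ L * B * R * r) (hB : ∀ i, ‖x i‖ ≤ B)
    (hy : ∀ i, ‖y i‖ ≤ L * (K * B)) (hz : ‖z‖ ≤ K * t)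
    {ψ : Fin t → Fin m → ℝ → ℝ} (hψ : ∀ j i x y, |ψ j i x - ψ j i y| ≤ L * |x - y|)
    (h0 : ∀ j i, ψ j i 0 = 0) :
    Compressible (fun (θ : {θ : (Fin t → EuclideanSpace ℝ (Fin d)) × EuclideanSpace ℝ (Fin t) //
      ∑ j, ‖θ.1 j‖ ^ 2 ≤ R ^ 2 ∧ ‖θ.2‖ ≤ (K + 1) * r}) i =>
        inner ℝ θ.1.2 z + inner ℝ θ.1.2 (y i) + ∑ j, θ.1.2 j * ψ j i (inner ℝ (θ.1.1 j) (x i))) 1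
      (((541 + K * (K + 1)) / c ^ 2 + 132 * ((K + 1) ^ 2 * K ^ 2 / c ^ 2) + 115200 * (K + 1) ^ 2) *
        (L ^ 2 * B ^ 2 * R ^ 2 * r ^ 2 *
          (Real.logb 2 ((d : ℝ) * m) ^ 2 * Real.logb 2 d + Real.logb 2 r + Real.logb 2 t))) := by
  have hd' : (2 : ℝ) ≤ d := by exact_mod_cast hd
  have ht' : (1 : ℝ) ≤ t := by exact_mod_cast ht
  have hm' : (1 : ℝ) ≤ m := by exact_mod_cast hm
  have hr' : 0 < (K + 1) * r := by positivity
  have hR0 : 0 < R := hc.trans_le hR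
  have hrt : 1 ≤ r * t := one_le_mul_of_one_le_of_one_le hr ht'
  have two : (1 : ℝ) < 2 := by norm_num
  -- The constant part is of size O(r t), so Rice parameter log₂(r t) leaves only O(1) bits for the
  -- quotient.
  set b' := ⌈Real.logb 2 (r * t)⌉₊ with hb'
  have hrtb : r * t ≤ 2 ^ b' := by
    have := Real.rpow_le_rpow_of_exponent_le two.le (Nat.le_ceil (Real.logb 2 (r * t)))
    rwa [Real.rpow_logb (by norm_num) (by norm_num) (by linarith), Real.rpow_natCast] at this
  have T1 := (Compressible.scalar (ι := Fin m)
    (s := fun θ : {θ : (Fin t → EuclideanSpace ℝ (Fin d)) × EuclideanSpace ℝ (Fin t) //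
      ∑ j, ‖θ.1 j‖ ^ 2 ≤ R ^ 2 ∧ ‖θ.2‖ ≤ (K + 1) * r} => inner ℝ θ.1.2 z)
    (Y := (K + 1) * r * (K * t)) (fun θ => (abs_real_inner_le_norm _ _).trans
      (mul_le_mul θ.2.2 hz (norm_nonneg _) hr'.le)) b').mono (V' := 1 / 4)
      (n' := b' + (K * (K + 1) + 1) + 2) le_rfl (by
        gcongr
        rw [div_le_iff₀ (by positivity)]
        have h1 : (1 : ℝ) ≤ 2 ^ b' := one_le_pow₀ two.le
        nlinarith [mul_le_mul_of_nonneg_left hrtb (by positivity : 0 ≤ K * (K + 1))])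
  have T2 := (((Compressible.sketch ht y hr' hy (Nat.le_pow_clog one_lt_two t)).average_of_pos
    (by positivity) (by positivity) (q := 4) (by norm_num)).comp
      (fun θ : {θ : (Fin t → EuclideanSpace ℝ (Fin d)) × EuclideanSpace ℝ (Fin t) //
        ∑ j, ‖θ.1 j‖ ^ 2 ≤ R ^ 2 ∧ ‖θ.2‖ ≤ (K + 1) * r} => ⟨θ.1.2, θ.2.2⟩))
  have hκ : m ≤ 4 ^ Nat.clog 2 m :=
    (Nat.le_pow_clog one_lt_two m).trans (Nat.pow_le_pow_left (by norm_num) _)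
  have T3 := (Compressible.neurons (by omega) ht x hR0 hr' hB (Nat.le_pow_clog one_lt_two d)
    (Nat.le_pow_clog one_lt_two t) hψ h0 hκ).average_of_pos
      (by positivity) (by positivity) (q := 2) (by norm_num)
  refine ((T1.add T2).add T3).mono (by norm_num) ?_
  have hXsq : c ^ 2 ≤ L ^ 2 * B ^ 2 * R ^ 2 * r ^ 2 := by
    calc c ^ 2 ≤ (L * B * R * r) ^ 2 := pow_le_pow_left₀ hc.le hX 2
      _ = _ := by ring
  have hlm : 0 ≤ Real.logb 2 (m : ℝ) := Real.logb_nonneg two hm'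
  have hmain := length_le (K := K) (c := c) (X := L ^ 2 * B ^ 2 * R ^ 2 * r ^ 2)
    (Z := ((K + 1) * r) ^ 2 * (L * (K * B)) ^ 2) (lg := Real.logb 2 ((d : ℝ) * m))
    (ld := Real.logb 2 d) (lm := Real.logb 2 m) (lr := Real.logb 2 r) (lt := Real.logb 2 t)
    (b := Nat.clog 2 d) (bt := Nat.clog 2 t) (κ := Nat.clog 2 m) (b' := b') hK hc hXsq ?_
    ((Real.le_logb_iff_rpow_le two (by linarith)).2 (by simpa using hd')) hlm
    (Real.logb_mul (by linarith) (by linarith)) (Real.logb_nonneg two hr)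
    (Real.logb_nonneg two ht') (clog_two_le (by omega)) (Nat.cast_nonneg _) (clog_two_le ht)
    (Nat.cast_nonneg _) (clog_two_le hm) ?_
  · refine le_trans (le_of_eq ?_) hmain
    ring
  -- The linear part has no factor R², which is supplied by R² / c² ≥ 1.
  · rw [div_mul_eq_mul_div, le_div_iff₀ (by positivity)]
    have : c ^ 2 ≤ R ^ 2 := pow_le_pow_left₀ hc.le hR 2
    calc _ = (K + 1) ^ 2 * K ^ 2 * (L ^ 2 * B ^ 2 * r ^ 2) * c ^ 2 := by ring
      _ ≤ (K + 1) ^ 2 * K ^ 2 * (L ^ 2 * B ^ 2 * r ^ 2) * R ^ 2 := by gcongr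
      _ = _ := by ring
  · rw [← Real.logb_mul (by linarith) (by linarith)]
    exact (Nat.ceil_lt_add_one (Real.logb_nonneg two hrt)).le

end ADL
end

/-! ### Reduction of the network class to the three-part decomposition -/

theorem theorem1 (K c : ℝ) (hc : 0 < c) :
    ∃ C : ℝ, 0 < C ∧
      ∀ (d t : ℕ) (X : Set (EuclideanSpace ℝ (Fin d)))
        (σ : EuclideanSpace ℝ (Fin t) → EuclideanSpace ℝ (Fin t))
        (W₀ : Matrix (Fin t) (Fin d) ℝ) (v₀ : EuclideanSpace ℝ (Fin t))
        (L : ℝ≥0) (B R r : ℝ),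
        2 ≤ d → 1 ≤ t →
        (∀ x ∈ X, ‖x‖ ≤ B) →
        LipschitzWith L σ → ADL.IsElementwise σ →
        -- the quantities that count as constants
        ADL.spectralNorm W₀ ≤ K → ‖v₀‖ ≤ K → (∀ j, |σ 0 j| ≤ K) →
        -- the parameters are in the range where the asymptotic bound is meaningful
        1 ≤ r → c ≤ R → c ≤ (L : ℝ) * B * R * r →
        ADL.HasADL (ADL.twoLayerClass X σ W₀ v₀ R r) fun m =>
          C * ((L : ℝ) ^ 2 * B ^ 2 * R ^ 2 * r ^ 2 *
            (Real.logb 2 ((d : ℝ) * m) ^ 2 * Real.logb 2 d + Real.logb 2 r + Real.logb 2 t)) := by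
  refine ⟨(541 + |K| * (|K| + 1)) / c ^ 2 + 132 * ((|K| + 1) ^ 2 * |K| ^ 2 / c ^ 2) +
    115200 * (|K| + 1) ^ 2, by positivity, ?_⟩
  intro d t X σ W₀ v₀ L B R r hd ht hB hσ hφ hW₀ hv₀ hσ0 hr hR hLB m A
  have hK : 0 ≤ K := (norm_nonneg _).trans hv₀
  rw [abs_of_nonneg hK]
  obtain ⟨φ, hφ⟩ := hφ
  -- Inputs supported on coordinate j transfer the Lipschitz bound from σ to each neuron.
  have hφL : ∀ j a b, |φ j a - φ j b| ≤ L * |a - b| := by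
    intro j a b
    have h := hσ.dist_le_mul (EuclideanSpace.single j a) (EuclideanSpace.single j b)
    rw [PiLp.dist_single_same, dist_eq_norm, Real.dist_eq] at h
    have h2 := PiLp.norm_apply_le
      (σ (EuclideanSpace.single j a) - σ (EuclideanSpace.single j b)) j
    rw [PiLp.sub_apply, hφ, hφ, Real.norm_eq_abs] at h2
    simpa using h2.trans h
  set lin : Matrix (Fin t) (Fin d) ℝ → Fin m → EuclideanSpace ℝ (Fin t) :=
    fun W i => Matrix.toEuclideanLin W (A i).1 with hlin
  have hW₀x : ∀ i, ‖lin W₀ i‖ ≤ K * B := fun i =>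
    ((LinearMap.toContinuousLinearMap (Matrix.toEuclideanLin W₀)).le_opNorm _).trans
      (mul_le_mul hW₀ (hB _ (A i).2) (norm_nonneg _) hK)
  have hsplit : ∀ (W : Matrix (Fin t) (Fin d) ℝ) i j, lin W i j = lin W₀ i j +
      inner ℝ (WithLp.toLp 2 fun k => (W - W₀) j k : EuclideanSpace ℝ (Fin d)) (A i).1 := by
    intro W i j
    simp only [hlin, Matrix.toLpLin_apply, Matrix.mulVec, dotProduct, PiLp.inner_apply,
      ← Finset.sum_add_distrib]
    refine Finset.sum_congr rfl fun k _ => ?_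
    simp
    ring
  refine ADL.Compressible.compressor ?_
  beta_reduce
  -- For m = 0 the convention log 0 = 0 removes the main term, but there is nothing to describe.
  rcases Nat.eq_zero_or_pos m with rfl | hm
  · have h0 : (fun f : ADL.restrict (ADL.twoLayerClass X σ W₀ v₀ R r) A => f.1) =
        fun _ _ => 0 := funext fun f => funext fun i => i.elim0
    rw [h0]
    refine ADL.Compressible.zero.mono zero_le_one ?_
    have h1 : 0 ≤ Real.logb 2 r := Real.logb_nonneg (by norm_num) hr
    have h2 : 0 ≤ Real.logb 2 (t : ℝ) := Real.logb_nonneg (by norm_num) (by exact_mod_cast ht)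
    simp only [Nat.cast_zero, mul_zero, Real.logb_zero, zero_pow two_ne_zero, zero_mul, zero_add]
    positivity
  -- The bound K √t is weakened to K t, harmless because it enters only through a logarithm.
  have hz : ‖σ 0‖ ≤ K * t := by
    have ht' : (1 : ℝ) ≤ t := by exact_mod_cast ht
    refine abs_le_of_sq_le_sq' ?_ (by positivity) |>.2
    rw [EuclideanSpace.real_norm_sq_eq]
    calc ∑ j, σ 0 j ^ 2 ≤ ∑ _j : Fin t, K ^ 2 := Finset.sum_le_sum fun j _ => by
          rw [← sq_abs]; exact pow_le_pow_left₀ (abs_nonneg _) (hσ0 j) 2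
      _ = K ^ 2 * t := by simp [mul_comm]
      _ ≤ K ^ 2 * t ^ 2 := by gcongr; nlinarith
      _ = _ := by ring
  have hy : ∀ i, ‖σ (lin W₀ i) - σ 0‖ ≤ L * (K * B) := fun i => by
    have := hσ.dist_le_mul (lin W₀ i) 0
    rw [dist_eq_norm, dist_zero_right] at this
    exact this.trans (mul_le_mul_of_nonneg_left (hW₀x i) L.2)
  have key := ADL.Compressible.network hd ht hm (fun i => (A i).1)
    (fun i => σ (lin W₀ i) - σ 0) (σ 0) hK hc hr hR hLB (fun i => hB _ (A i).2) hy hz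
    -- The increments start from W₀ x, so they depend on the input index i; the decoder knows the
    -- inputs, W₀ and σ.
    (ψ := fun j i s => φ j (lin W₀ i j + s) - φ j (lin W₀ i j))
    (fun j i a b => by simpa using hφL j (lin W₀ i j + a) (lin W₀ i j + b)) (fun j i => by simp)
  have hex : ∀ f : ADL.restrict (ADL.twoLayerClass X σ W₀ v₀ R r) A,
      ∃ (W : Matrix (Fin t) (Fin d) ℝ) (v : EuclideanSpace ℝ (Fin t)),
        ADL.frobeniusNorm (W - W₀) ≤ R ∧ ‖v - v₀‖ ≤ r ∧
          f.1 = fun i => inner ℝ v (σ (lin W i)) := by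
    rintro ⟨_, _, ⟨W, v, hW, hv, rfl⟩, rfl⟩
    exact ⟨W, v, hW, hv, rfl⟩
  -- Fixing parameters for each function lets the encoder describe them instead of the function.
  choose W v hW hv hf using hex
  have hU : ∀ f, ∑ j, ‖(WithLp.toLp 2 fun k => (W f - W₀) j k : EuclideanSpace ℝ (Fin d))‖ ^ 2 ≤
      R ^ 2 := fun f => by
    have h1 := (Real.sqrt_le_left (hc.le.trans hR)).1 (hW f)
    simpa only [EuclideanSpace.real_norm_sq_eq] using h1
  have hvf : ∀ f, ‖v f‖ ≤ (K + 1) * r := fun f => by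
    have h1 : ‖v f‖ ≤ ‖v f - v₀‖ + ‖v₀‖ := by simpa using norm_add_le (v f - v₀) v₀
    nlinarith [hv f]
  convert key.comp (fun f : ADL.restrict (ADL.twoLayerClass X σ W₀ v₀ R r) A =>
    ⟨(fun j => WithLp.toLp 2 fun k => (W f - W₀) j k, v f), hU f, hvf f⟩) using 1
  funext f i
  rw [hf f]
  have hsum : ∑ j, v f j * (φ j (lin W₀ i j +
      inner ℝ (WithLp.toLp 2 fun k => (W f - W₀) j k : EuclideanSpace ℝ (Fin d)) (A i).1) -
        φ j (lin W₀ i j)) = inner ℝ (v f) (σ (lin (W f) i) - σ (lin W₀ i)) := by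
    rw [PiLp.inner_apply]
    refine Finset.sum_congr rfl fun j _ => ?_
    rw [← hsplit, PiLp.sub_apply, hφ, hφ]
    simp [mul_comm]
  simp only [hsum, ← inner_add_right]
  congr 1
  abel
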